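/- **Theorem (secrecy capacity in the bandwidth-limited regime).** *Model.* A distributed storage system $\mathcal D(n,k)$ with repair degree $d$ has $n$ active storage nodes at every time. A file $S$, uniformly distributed over $\mathbb F_q^R$ for a finite field $\mathbb F_q$, is encoded by a (randomized) source into the contents of the $n$ initial nodes; each node stores at most $\alpha$ data units. Nodes fail one at a time, in any order. A failed node is immediately replaced by a new one, which connects to $d$ other active nodes (any $d$ of them) and downloads from each of them at most $\beta$ units, computed from what that node stores; $\gamma=d\beta$ is the repair bandwidth. The new node stores a function of what it downloads. Let $C_i$ be the content of node $i$ and $D_i$ the data revealed to an eavesdropper who accesses node $i$: everything node $i$ downloads if it is a replacement node, and $D_i=C_i$ if it is one of the initial nodes. A data unit consists of a fixed number $m\ge 1$ of symbols of $\mathbb F_q$ (for $m=1$ a unit is a symbol); the entropy $H$ is measured in data units, so $H(S)=R/m$. The numbers of symbols stored and downloaded per link are integers. The secrecy capacity $C_s(\alpha,\gamma)$ is the supremum of $H(S)$ over all such schemes with, for all sequences of failures and repairs, $H(S\mid C_B)=0$ for every set $B$ of $k$ simultaneously active nodes (reconstruction), and $H(S\mid D_E)=H(S)$ for every set $E$ of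 at most $\ell$ nodes among all nodes that ever exist (perfect secrecy). The field $\mathbb F_q$ and the number $m$ of symbols per unit are free to choose; let $C_s^{q,m}$ be the same supremum for fixed $\mathbb F_q$ and $m$. For $\Gamma\ge 0$ put $$C_s^{BL}(\Gamma)=\sup_{0\le\gamma\le\Gamma,\ \alpha\ge 0} C_s(\alpha,\gamma),$$ and define $C_s^{BL,q,m}(\Gamma)$ in the same way from $C_s^{q,m}$. *Statement.* Let $0\le\ell<k\le n-1$, $d=n-1$, and $\Gamma\ge 0$ real. Then $$C_s^{BL}(\Gamma)=\sum_{i=\ell+1}^{k}(n-i)\,\frac{\Gamma}{n-1},$$ and this value is achieved with node storage $\alpha=\Gamma$: $C_s(\Gamma,\Gamma)=C_s^{BL}(\Gamma)$. Moreover, if $m\Gamma/(n-1)=b$ is an integer (for instance $m=1$ and $\Gamma=(n-1)b$), then over every finite field with $q\ge n(n-1)/2$ one has $C_s^{BL,q,m}(\Gamma)=C_s^{q,m}(\Gamma,\Gamma)=\sum_{i=\ell+1}^{k}(n-i)\frac{\Gamma}{n-1}$, and the supremum is attained: there is a scheme with perfect secrecy and the reconstruction property in which each node stores $(n-1)b=m\Gamma$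 symbols, each repair downloads $b$ symbols from each of the other $n-1$ active nodes, and the file has $\sum_{i=\ell+1}^{k}(n-i)b$ symbols. -/

import Mathlib

noncomputable section

/-! ### Shannon entropy of finite random variables -/

/-- Shannon entropy `H(X)`, in base `q`, of a finitely valued random variable `X` on a
probability space with law `p`. -/
def shannonEntropy (q : ℝ) {Ω A : Type*} [Fintype A] (p : PMF Ω) (X : Ω → A) : ℝ :=
  (∑ x, Real.negMulLog ((p.map X) x).toReal) / Real.log q

/-- Conditional entropy `H(X | Y) = - ∑ P(x, y) log_q (P(x, y) / P(y))`.  Terms with `P(x, y) = 0`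
(in particular those with `P(y) = 0`) are zero. -/
def shannonCondEntropy (q : ℝ) {Ω A B : Type*} [Fintype A] [Fintype B] (p : PMF Ω)
    (X : Ω → A) (Y : Ω → B) : ℝ :=
  (∑ y, ∑ x, -(((p.map fun ω => (X ω, Y ω)) (x, y)).toReal *
    Real.log (((p.map fun ω => (X ω, Y ω)) (x, y)).toReal / ((p.map Y) y).toReal))) / Real.log q

/-! ### Distributed storage systems under failures and repairs -/

/-- One failure with its repair.  The `n` active nodes occupy the slots `Fin n`; the node in slot
`failed` is replaced by a new node, which connects to the `d` active nodes in `helpers`. -/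
structure RepairEvent (n d : ℕ) where
  failed : Fin n
  helpers : Finset (Fin n)
  card_helpers : helpers.card = d
  failed_notMem : failed ∉ helpers

/-- The first `t` events of a failure pattern, in chronological order. -/
def pastEvents {n d : ℕ} (σ : ℕ → RepairEvent n d) (t : ℕ) : List (RepairEvent n d) :=
  (List.range t).map σ

/-- A storage and repair scheme over the alphabet `F` with repair degree `d`: the file has `R`
symbols, each node stores `a` symbols, a new node downloads `b` symbols from each of its `d`
helpers.  All coding functions are arbitrary, and may depend on the failures and repairs so far.

* `encode`: the (randomized) encoder of the source, from the file to the initial contents;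
* `send h e j`: the message sent for the repair `e`, after the past events `h`, by the node in
  slot `j`, as a function of what this node stores;
* `regenerate h e`: what the new node stores, as a function of what it downloads (a tuple indexed
  by all slots, with `0` at slots that are not contacted). -/
structure StorageScheme (F : Type) (n d a b R : ℕ) where
  encode : (Fin R → F) → PMF (Fin n → Fin a → F)
  send : List (RepairEvent n d) → RepairEvent n d → Fin n → (Fin a → F) → (Fin b → F)
  regenerate : List (RepairEvent n d) → RepairEvent n d → (Fin n → Fin b → F) → (Fin a → F)

namespace StorageScheme

variable {F : Type} [Field F] [Fintype F] {n d a b R : ℕ}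

/-- Joint law of the file `S`, uniform on `F ^ R`, and of the initial contents of the nodes. -/
def law (sch : StorageScheme F n d a b R) : PMF ((Fin R → F) × (Fin n → Fin a → F)) :=
  (PMF.uniformOfFintype (Fin R → F)).bind fun s => (sch.encode s).map fun c => (s, c)

/-- What the new node downloads in the repair `σ t`, if the slots have contents `c` before it. -/
def download (sch : StorageScheme F n d a b R) (σ : ℕ → RepairEvent n d) (t : ℕ)
    (c : Fin n → Fin a → F) : Fin n → Fin b → F :=
  open Classical in fun j =>
    if j ∈ (σ t).helpers then sch.send (pastEvents σ t) (σ t) j (c j) else 0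

/-- The contents of the active nodes after the first `t` failures and repairs of the failure
pattern `σ`, as a function of the outcome of the source. -/
def stored (sch : StorageScheme F n d a b R) (σ : ℕ → RepairEvent n d) :
    ℕ → (Fin R → F) × (Fin n → Fin a → F) → Fin n → Fin a → F
  | 0, ω => ω.2
  | t + 1, ω => Function.update (stored sch σ t ω) (σ t).failed
      (sch.regenerate (pastEvents σ t) (σ t) (sch.download σ t (stored sch σ t ω)))

/-- The data revealed to an eavesdropper who accesses a node.  The nodes are the initial ones,
`Sum.inl i`, which receive their contents from the source, and the replacement nodes `Sum.inr t`
(the one added in the repair `σ t`), which reveal everything they download. -/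
def revealed (sch : StorageScheme F n d a b R) (σ : ℕ → RepairEvent n d)
    (ω : (Fin R → F) × (Fin n → Fin a → F)) :
    Fin n ⊕ ℕ → (Fin a → F) ⊕ (Fin n → Fin b → F)
  | Sum.inl i => Sum.inl (ω.2 i)
  | Sum.inr t => Sum.inr (sch.download σ t (sch.stored σ t ω))

/-- `H(S)`, in symbols of `F`. -/
def fileEntropy (sch : StorageScheme F n d a b R) : ℝ :=
  shannonEntropy (Fintype.card F) sch.law Prod.fst

/-- Reconstruction property: `H(S | C_B) = 0` for every set `B` of `k` nodes that are active at
the same time, whatever the failures and repairs. -/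
def Reconstructs (sch : StorageScheme F n d a b R) (k : ℕ) : Prop :=
  ∀ (σ : ℕ → RepairEvent n d) (t : ℕ) (B : Finset (Fin n)), B.card = k →
    shannonCondEntropy (Fintype.card F) sch.law Prod.fst
      (fun ω (i : {i // i ∈ B}) => sch.stored σ t ω i) = 0

/-- Perfect secrecy: `H(S | D_E) = H(S)` for every set `E` of at most `ℓ` nodes among all nodes
that ever exist, whatever the failures and repairs. -/
def Secure (sch : StorageScheme F n d a b R) (ℓ : ℕ) : Prop :=
  ∀ (σ : ℕ → RepairEvent n d) (E : Finset (Fin n ⊕ ℕ)), E.card ≤ ℓ →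
    shannonCondEntropy (Fintype.card F) sch.law Prod.fst
      (fun ω (v : {v // v ∈ E}) => sch.revealed σ ω v) = sch.fileEntropy

end StorageScheme

/-! ### Secrecy capacity

The parameters are the number `n` of active nodes, the number `k` of nodes contacted by a data
collector, the repair degree `d`, and the number `ℓ` of compromised nodes.  The node storage `α`
and the repair bandwidth `γ` are measured in data units. -/

/-- Secrecy capacity `C_s(α, γ)` when a data unit consists of `m` symbols of the field `F`: the
supremum of `H(S)`, in data units, over all schemes with the reconstruction property and perfect
secrecy whose nodes store at most `α` units and download at most `γ / d` units from each of the
`d` helpers.  For `m = 1` a unit is a symbol of `F`. -/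
def secrecyCapacityOver (F : Type) [Field F] [Fintype F] (m n k d ℓ : ℕ) (α γ : ℝ) : EReal :=
  ⨆ (a : ℕ) (b : ℕ) (R : ℕ) (sch : StorageScheme F n d a b R)
    (_ : (a : ℝ) ≤ m * α ∧ (d : ℝ) * b ≤ m * γ ∧ sch.Reconstructs k ∧ sch.Secure ℓ),
    ((sch.fileEntropy / m : ℝ) : EReal)

/-- Secrecy capacity `C_s(α, γ)`, with the finite field and the number of its symbols per data unit
free to choose. -/
def secrecyCapacity (n k d ℓ : ℕ) (α γ : ℝ) : EReal :=
  ⨆ (F : Type) (_ : Field F) (_ : Fintype F) (m : ℕ) (_ : 0 < m),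
    secrecyCapacityOver F m n k d ℓ α γ

/-- Secrecy capacity in the bandwidth-limited regime: `γ ≤ Γ`, with no bound on `α`; the data unit
consists of `m` symbols of `F`. -/
def bandwidthLimitedCapacityOver (F : Type) [Field F] [Fintype F] (m n k d ℓ : ℕ) (Γ : ℝ) :
    EReal :=
  ⨆ (γ : ℝ) (_ : 0 ≤ γ ∧ γ ≤ Γ) (α : ℝ) (_ : 0 ≤ α), secrecyCapacityOver F m n k d ℓ α γ

/-- Secrecy capacity `C_s^{BL}(Γ)` in the bandwidth-limited regime. -/
def bandwidthLimitedCapacity (n k d ℓ : ℕ) (Γ : ℝ) : EReal :=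
  ⨆ (γ : ℝ) (_ : 0 ≤ γ ∧ γ ≤ Γ) (α : ℝ) (_ : 0 ≤ α), secrecyCapacity n k d ℓ α γ

end

/-! Upper bound. Let the slots 0, ..., k - 1 fail in order, and let the eavesdropper access the
first ℓ replacement nodes. Secrecy leaves the file with maximal conditional entropy, so some value
of the observed data is compatible with every file (`exists_forall_compatible_of_log_card_le`). Fix
such a value and one outcome of the source per file. The i-th new node downloads from slots already
replaced, whose contents are determined by earlier downloads, and from n - i slots that have not
failed. Hence the messages from the latter for i = ℓ + 1, ..., k determine the contents of k active
nodes, and so the file. Counting values gives R ≤ ∑ (n - i) b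
(`StorageScheme.size_le_of_reconstructs_of_secure`).

Attainment. Put b symbols on each edge of the complete graph on the slots and store them at both
endpoints. A repair copies the lost symbols from the other endpoints, so the contents never change
and a replacement node reveals what its slot always held. The symbols on the edges are values, at
distinct points, of b polynomials whose K lowest coefficients are random and whose next N
coefficients are the file. A set of j slots meets ∑_{i ≤ j} (n - i) edges. With K and N the sums
over i ≤ ℓ and over ℓ < i ≤ k, any k slots give enough values to interpolate, while the values seen
from ℓ slots can be matched for any other file by a shift of the randomness.

For real Γ, let the number m of symbols per unit tend to infinity and round the link load down to a
whole number of symbols. -/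

/-! ### Extreme values of conditional entropy -/

section Entropy

variable {Ω A B : Type*} (p : PMF Ω) (X : Ω → A) (Y : Ω → B)

/-- The probability that `(X, Y) = (x, y)`, as a real number. -/
noncomputable def jointProb (p : PMF Ω) (X : Ω → A) (Y : Ω → B) (x : A) (y : B) : ℝ :=
  ((p.map fun ω => (X ω, Y ω)) (x, y)).toReal

theorem jointProb_nonneg (x : A) (y : B) : 0 ≤ jointProb p X Y x y := ENNReal.toReal_nonneg

theorem sum_toReal_pmf {C : Type*} [Fintype C] (p : PMF C) : ∑ c, (p c).toReal = 1 := by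
  rw [← ENNReal.toReal_sum fun c _ => p.apply_ne_top c, ← tsum_fintype (L := .unconditional _),
    p.tsum_coe, ENNReal.toReal_one]

theorem jointProb_pos_iff {x : A} {y : B} :
    0 < jointProb p X Y x y ↔ ∃ ω ∈ p.support, X ω = x ∧ Y ω = y := by
  rw [jointProb, ENNReal.toReal_pos_iff, and_iff_left (lt_of_le_of_ne le_top (PMF.apply_ne_top _ _)),
    pos_iff_ne_zero, ← PMF.mem_support_iff, PMF.mem_support_map_iff]
  simp [Prod.ext_iff]

variable [Fintype A] [Fintype B]

theorem sum_jointProb (y : B) : ∑ x, jointProb p X Y x y = ((p.map Y) y).toReal := by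
  classical
  have h : p.map Y = (p.map fun ω => (X ω, Y ω)).map Prod.snd := by
    rw [PMF.map_comp]; rfl
  rw [h, PMF.map_apply, tsum_fintype, Fintype.sum_prod_type]
  simp only [jointProb]
  rw [← ENNReal.toReal_sum fun c _ => PMF.apply_ne_top _ _]
  congr 1
  refine Finset.sum_congr rfl fun x _ => ?_
  simp

theorem jointProb_le (x : A) (y : B) : jointProb p X Y x y ≤ ((p.map Y) y).toReal := by
  rw [← sum_jointProb p X Y y]
  exact Finset.single_le_sum (fun x _ => jointProb_nonneg p X Y x y) (Finset.mem_univ x)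

theorem neg_jointProb_mul_log_nonneg (x : A) (y : B) :
    0 ≤ -(jointProb p X Y x y * Real.log (jointProb p X Y x y / ((p.map Y) y).toReal)) := by
  rw [neg_nonneg]
  refine mul_nonpos_of_nonneg_of_nonpos (jointProb_nonneg ..) (Real.log_nonpos ?_ ?_)
  · exact div_nonneg (jointProb_nonneg ..) ENNReal.toReal_nonneg
  · exact div_le_one_of_le₀ (jointProb_le ..) ENNReal.toReal_nonneg

theorem shannonCondEntropy_eq_jointProb (q : ℝ) : shannonCondEntropy q p X Y =
    (∑ y, ∑ x, -(jointProb p X Y x y *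
      Real.log (jointProb p X Y x y / ((p.map Y) y).toReal))) / Real.log q := rfl

/-- All terms of the entropy are nonnegative, so each vanishes and every positive P(x, y) equals
P(y). Two distinct values of `X` over the same y would give 2 P(y) ≤ P(y). -/
theorem eq_of_shannonCondEntropy_eq_zero {q : ℝ} (hq : 1 < q)
    (h : shannonCondEntropy q p X Y = 0) {ω ω' : Ω} (hω : ω ∈ p.support) (hω' : ω' ∈ p.support)
    (hY : Y ω = Y ω') : X ω = X ω' := by
  classical
  rw [shannonCondEntropy_eq_jointProb, div_eq_zero_iff, or_iff_left (Real.log_pos hq).ne',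
    Finset.sum_eq_zero_iff_of_nonneg
      fun y _ => Finset.sum_nonneg fun x _ => neg_jointProb_mul_log_nonneg p X Y x y] at h
  have h' := h (Y ω) (Finset.mem_univ _)
  rw [Finset.sum_eq_zero_iff_of_nonneg fun x _ => neg_jointProb_mul_log_nonneg p X Y x _] at h'
  have key : ∀ x, 0 < jointProb p X Y x (Y ω) →
      jointProb p X Y x (Y ω) = ((p.map Y) (Y ω)).toReal := by
    intro x hx
    have hy := hx.trans_le (jointProb_le p X Y x (Y ω))
    have h1 := h' x (Finset.mem_univ _)
    rw [neg_eq_zero, mul_eq_zero, or_iff_right hx.ne'] at h1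
    exact (div_eq_one_iff_eq hy.ne').1 (Real.eq_one_of_pos_of_log_eq_zero (div_pos hx hy) h1)
  have p1 : 0 < jointProb p X Y (X ω) (Y ω) := (jointProb_pos_iff ..).2 ⟨ω, hω, rfl, rfl⟩
  have p2 : 0 < jointProb p X Y (X ω') (Y ω) := (jointProb_pos_iff ..).2 ⟨ω', hω', rfl, hY.symm⟩
  by_contra hne
  have h3 : jointProb p X Y (X ω) (Y ω) + jointProb p X Y (X ω') (Y ω)
      ≤ ((p.map Y) (Y ω)).toReal := by
    rw [← sum_jointProb p X Y, ← Finset.sum_pair hne (f := fun x => jointProb p X Y x (Y ω))]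
    exact Finset.sum_le_sum_of_subset_of_nonneg (Finset.subset_univ _)
      fun x _ _ => jointProb_nonneg ..
  have := key _ p1
  linarith

theorem shannonCondEntropy_eq_zero (q : ℝ)
    (h : ∀ ω ∈ p.support, ∀ ω' ∈ p.support, Y ω = Y ω' → X ω = X ω') :
    shannonCondEntropy q p X Y = 0 := by
  rw [shannonCondEntropy_eq_jointProb]
  have : ∀ y x, -(jointProb p X Y x y *
      Real.log (jointProb p X Y x y / ((p.map Y) y).toReal)) = 0 := by
    intro y x
    rcases (jointProb_nonneg p X Y x y).eq_or_lt with h0 | h0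
    · simp [← h0]
    · have : ((p.map Y) y).toReal = jointProb p X Y x y := by
        rw [← sum_jointProb p X Y]
        refine Finset.sum_eq_single x (fun x' _ hx' => ?_) (by simp)
        by_contra hne
        obtain ⟨ω, hω, hx, hy⟩ := (jointProb_pos_iff ..).1 h0
        obtain ⟨ω', hω', hx'', hy'⟩ :=
          (jointProb_pos_iff ..).1 ((jointProb_nonneg p X Y x' y).lt_of_ne' hne)
        exact hx' (by rw [← hx, ← hx'', h ω hω ω' hω' (hy.trans hy'.symm)])
      rw [this, div_self h0.ne', Real.log_one, mul_zero, neg_zero]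
  simp only [this, Finset.sum_const_zero, zero_div]

/-- If conditioning on `Y` does not bring the entropy of `X` below its largest possible value, then
some value of `Y` is compatible with every value of `X`. -/
theorem exists_forall_compatible_of_log_card_le [Nonempty A] {q : ℝ} (hq : 1 < q)
    (h : Real.log (Fintype.card A) / Real.log q ≤ shannonCondEntropy q p X Y) :
    ∃ y, ∀ x, ∃ ω ∈ p.support, X ω = x ∧ Y ω = y := by
  rw [shannonCondEntropy_eq_jointProb, div_le_div_iff_of_pos_right (Real.log_pos hq)] at h
  by_contra! hcon
  have hA : (0 : ℝ) < Fintype.card A := by exact_mod_cast Fintype.card_pos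
  -- Gibbs' inequality term by term: log z ≤ z - 1 at z = P(y) / (P(x, y) |A|). The correction in
  -- parentheses sums to zero over x, and it is strictly positive where P(x, y) = 0 < P(y).
  have term : ∀ x y, -(jointProb p X Y x y *
      Real.log (jointProb p X Y x y / ((p.map Y) y).toReal)) ≤
      jointProb p X Y x y * Real.log (Fintype.card A) +
        (((p.map Y) y).toReal / Fintype.card A - jointProb p X Y x y) := by
    intro x y
    rcases (jointProb_nonneg p X Y x y).eq_or_lt with h0 | h0
    · simp only [← h0]
      simp only [zero_mul, neg_zero, zero_add, sub_zero]
      positivity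
    · have hy := h0.trans_le (jointProb_le p X Y x y)
      set u := jointProb p X Y x y
      set v := ((p.map Y) y).toReal
      have := Real.log_le_sub_one_of_pos (show 0 < v / (u * Fintype.card A) by positivity)
      rw [Real.log_div hy.ne' (by positivity), Real.log_mul h0.ne' hA.ne'] at this
      rw [Real.log_div h0.ne' hy.ne']
      have h2 := mul_le_mul_of_nonneg_left this h0.le
      have h3 : u * (v / (u * Fintype.card A) - 1) = v / Fintype.card A - u := by
        field_simp
      linarith
  have rhs : ∀ y, ∑ x, (jointProb p X Y x y * Real.log (Fintype.card A) +
        (((p.map Y) y).toReal / Fintype.card A - jointProb p X Y x y)) =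
        ((p.map Y) y).toReal * Real.log (Fintype.card A) := by
    intro y
    rw [Finset.sum_add_distrib, Finset.sum_sub_distrib, ← Finset.sum_mul, sum_jointProb,
      Finset.sum_const, Finset.card_univ, nsmul_eq_mul]
    field_simp
    ring
  have hlt : ∑ y, ∑ x, -(jointProb p X Y x y *
      Real.log (jointProb p X Y x y / ((p.map Y) y).toReal)) <
      ∑ y, ((p.map Y) y).toReal * Real.log (Fintype.card A) := by
    refine Finset.sum_lt_sum
      (fun y _ => (Finset.sum_le_sum fun x _ => term x y).trans_eq (rhs y)) ?_
    obtain ⟨y, hy⟩ := (p.map Y).support_nonempty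
    have hy0 : 0 < ((p.map Y) y).toReal :=
      ENNReal.toReal_pos ((PMF.mem_support_iff _ _).1 hy) (PMF.apply_ne_top _ _)
    obtain ⟨x, hx⟩ := hcon y
    have hx0 : jointProb p X Y x y = 0 := by
      by_contra hne
      obtain ⟨ω, hω, h1, h2⟩ :=
        (jointProb_pos_iff ..).1 ((jointProb_nonneg p X Y x y).lt_of_ne' hne)
      exact hx ω hω h1 h2
    refine ⟨y, Finset.mem_univ _, (Finset.sum_lt_sum (fun x _ => term x y)
      ⟨x, Finset.mem_univ _, ?_⟩).trans_eq (rhs y)⟩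
    simp only [hx0, zero_mul, neg_zero, zero_add, sub_zero]
    positivity
  rw [← Finset.sum_mul, sum_toReal_pmf, one_mul] at hlt
  linarith

theorem shannonCondEntropy_eq_shannonEntropy (q : ℝ)
    (h : ∀ x y, (p.map fun ω => (X ω, Y ω)) (x, y) = (p.map X) x * (p.map Y) y) :
    shannonCondEntropy q p X Y = shannonEntropy q p X := by
  rw [shannonCondEntropy, shannonEntropy]
  congr 1
  have : ∀ y, ∑ x, -(((p.map fun ω => (X ω, Y ω)) (x, y)).toReal *
      Real.log (((p.map fun ω => (X ω, Y ω)) (x, y)).toReal / ((p.map Y) y).toReal)) =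
      ((p.map Y) y).toReal * ∑ x, Real.negMulLog ((p.map X) x).toReal := by
    intro y
    rw [Finset.mul_sum]
    refine Finset.sum_congr rfl fun x _ => ?_
    rw [h, ENNReal.toReal_mul, Real.negMulLog]
    rcases eq_or_ne ((p.map Y) y).toReal 0 with h0 | h0
    · rw [h0, mul_zero, zero_mul, zero_mul, neg_zero]
    · rw [mul_div_cancel_right₀ _ h0]
      ring
  simp_rw [this]
  rw [← Finset.sum_mul, sum_toReal_pmf, one_mul]

end Entropy

theorem shannonEntropy_of_map_eq_uniform {Ω A : Type*} [Fintype A] [Nonempty A] (p : PMF Ω)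
    (X : Ω → A) (q : ℝ)
    (h : p.map X = PMF.uniformOfFintype A) :
    shannonEntropy q p X = Real.log (Fintype.card A) / Real.log q := by
  have hA : (Fintype.card A : ℝ) ≠ 0 := by exact_mod_cast Fintype.card_ne_zero
  simp [shannonEntropy, h, Real.negMulLog, hA]

theorem map_uniformOfFintype_equiv {A : Type*} [Fintype A] [Nonempty A] (e : A ≃ A) :
    (PMF.uniformOfFintype A).map e = PMF.uniformOfFintype A := by
  classical
  ext x
  rw [PMF.map_apply, tsum_eq_single (e.symm x)]
  · simp
  · intro y hy
    rw [if_neg]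
    rintro rfl
    simp at hy

/-! ### Converse: counting along sequential failures -/

namespace StorageScheme

variable {F : Type} [Field F] [Fintype F] {n d a b R : ℕ}

theorem one_lt_card_real (F : Type) [Field F] [Fintype F] : (1 : ℝ) < Fintype.card F := by
  exact_mod_cast Fintype.one_lt_card (α := F)

theorem map_fst_law (sch : StorageScheme F n d a b R) :
    sch.law.map Prod.fst = PMF.uniformOfFintype (Fin R → F) := by
  rw [law, PMF.map_bind]
  simp_rw [PMF.map_comp]
  have : ∀ s : Fin R → F, (Prod.fst ∘ fun c : Fin n → Fin a → F => (s, c)) =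
      Function.const _ s := fun s => rfl
  simp_rw [this, PMF.map_const, PMF.bind_pure]

theorem fileEntropy_eq_log (sch : StorageScheme F n d a b R) : sch.fileEntropy =
    Real.log (Fintype.card (Fin R → F)) / Real.log (Fintype.card F) :=
  shannonEntropy_of_map_eq_uniform _ _ _ sch.map_fst_law

theorem fileEntropy_eq (sch : StorageScheme F n d a b R) : sch.fileEntropy = R := by
  have := (Real.log_pos (one_lt_card_real F)).ne'
  rw [fileEntropy_eq_log, Fintype.card_fun, Fintype.card_fin, Nat.cast_pow, Real.log_pow]
  field_simp

theorem mem_support_law (sch : StorageScheme F n d a b R) {ω : (Fin R → F) × (Fin n → Fin a → F)} :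
    ω ∈ sch.law.support ↔ ω.2 ∈ (sch.encode ω.1).support := by
  obtain ⟨s, c⟩ := ω
  simp [law]

/-- The failure pattern in which the slots fail one after the other, in order. -/
def sequentialRepairs (n : ℕ) [NeZero n] (t : ℕ) : RepairEvent n (n - 1) where
  failed := Fin.ofNat n t
  helpers := Finset.univ.erase (Fin.ofNat n t)
  card_helpers := by simp [Finset.card_erase_of_mem]
  failed_notMem := by simp

-- In repair t the slots below t already agree by induction and slot t, the failed one, contributes
-- 0. Only messages from slots above t need to be assumed equal. The first alternative serves the
-- repairs that are eavesdropped, the second the others.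
omit [Fintype F] in
theorem stored_eq_of_sequentialRepairs [NeZero n] (sch : StorageScheme F n (n - 1) a b R) {k : ℕ}
    (hk : k ≤ n) (ω ω' : (Fin R → F) × (Fin n → Fin a → F))
    (h : ∀ t < k, (sch.download (sequentialRepairs n) t (sch.stored (sequentialRepairs n) t ω) =
        sch.download (sequentialRepairs n) t (sch.stored (sequentialRepairs n) t ω')) ∨
      ∀ j : Fin n, t < j →
        sch.download (sequentialRepairs n) t (sch.stored (sequentialRepairs n) t ω) j =
        sch.download (sequentialRepairs n) t (sch.stored (sequentialRepairs n) t ω') j) :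
    ∀ t ≤ k, ∀ j : Fin n, (j : ℕ) < t →
      sch.stored (sequentialRepairs n) t ω j = sch.stored (sequentialRepairs n) t ω' j := by
  intro t
  induction t with
  | zero => intro _ j hj; omega
  | succ t ih =>
    intro ht j hj
    have ih' := ih (by omega)
    have hft : ((Fin.ofNat n t : Fin n) : ℕ) = t := by
      simp [Nat.mod_eq_of_lt (show t < n by omega)]
    have hd : sch.download (sequentialRepairs n) t (sch.stored (sequentialRepairs n) t ω) =
        sch.download (sequentialRepairs n) t (sch.stored (sequentialRepairs n) t ω') := by
      rcases h t (by omega) with h | h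
      · exact h
      · funext i
        rcases lt_trichotomy (i : ℕ) t with hi | hi | hi
        · simp only [download, ih' i hi]
        · have : i = Fin.ofNat n t := Fin.ext (by rw [hi, hft])
          simp [download, sequentialRepairs, this]
        · exact h i hi
    simp only [stored, hd]
    by_cases hjt : j = (sequentialRepairs n t).failed
    · subst hjt; simp
    · rw [Function.update_of_ne hjt, Function.update_of_ne hjt]
      refine ih' j (lt_of_le_of_ne (by omega) fun hjt' => hjt (Fin.ext ?_))
      rw [hjt']; exact hft.symm

/-- Converse bound: a file that is reconstructed from any `k` nodes and kept secret from any `ℓ`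
nodes has at most `∑ (n - i) b` symbols. -/
theorem size_le_of_reconstructs_of_secure (sch : StorageScheme F n (n - 1) a b R) {k ℓ : ℕ}
    (hℓ : ℓ < k) (hk : k ≤ n) (hrec : sch.Reconstructs k) (hsec : sch.Secure ℓ) :
    R ≤ ∑ i ∈ Finset.Icc (ℓ + 1) k, (n - i) * b := by
  classical
  have : NeZero n := ⟨by omega⟩
  set σ := sequentialRepairs n
  have hE := hsec σ ((Finset.range ℓ).map ⟨Sum.inr, Sum.inr_injective⟩) (by simp)
  rw [fileEntropy_eq_log] at hE
  obtain ⟨y, hy⟩ := exists_forall_compatible_of_log_card_le _ _ _ (one_lt_card_real F) hE.ge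
  choose ω hω hS hD using hy
  -- The index i stands for the repair number i - 1, counted from 0, so `Finset.Ico i n` lists the n
  -- - i slots that have not failed by the end of that repair.
  let I := (Finset.Icc (ℓ + 1) k).sigma fun i => Finset.Ico i n
  let M : (Fin R → F) → I → Fin b → F := fun s x =>
    sch.download σ (x.1.1 - 1) (sch.stored σ (x.1.1 - 1) (ω s)) (Fin.ofNat n x.1.2)
  have hM : Function.Injective M := by
    intro s s' hss
    -- For t < ℓ the downloads agree because both outcomes reveal the same y; for later t the
    -- equality of `M` supplies the messages from the slots above t.
    have key := sch.stored_eq_of_sequentialRepairs hk (ω s) (ω s') (fun t ht => by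
      by_cases htl : t < ℓ
      · left
        have h1 := congrFun ((hD s).trans (hD s').symm)
          ⟨Sum.inr t, by simpa using htl⟩
        exact Sum.inr_injective h1
      · right
        intro j hj
        have h1 := congrFun hss ⟨⟨t + 1, j⟩, by
          simp only [I, Finset.mem_sigma, Finset.mem_Icc, Finset.mem_Ico]
          omega⟩
        have h2 : Fin.ofNat n (j : ℕ) = j := by simp
        simpa [M, h2] using h1) k le_rfl
    have hB := hrec σ k (Finset.univ.filter fun j : Fin n => (j : ℕ) < k) (by
      rw [← Fintype.card_subtype, Fintype.card_subtype, Fin.card_filter_val_lt, min_eq_right hk])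
    have := eq_of_shannonCondEntropy_eq_zero _ _ _ (one_lt_card_real F) hB (hω s) (hω s')
      (funext fun j => key j.1 (Finset.mem_filter.1 j.2).2)
    rwa [hS, hS] at this
  have hcard := Fintype.card_le_of_injective M hM
  rw [Fintype.card_fun, Fintype.card_fun, Fintype.card_fun, ← pow_mul, Fintype.card_fin,
    Fintype.card_fin, Fintype.card_coe] at hcard
  have := (Nat.pow_le_pow_iff_right (Fintype.one_lt_card (α := F))).1 hcard
  rw [Finset.card_sigma] at this
  simp only [Nat.card_Ico] at this
  rwa [← Finset.sum_mul, mul_comm]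

end StorageScheme

/-! ### Polynomial interpolation -/

open Polynomial in
/-- Two vectors of coefficients of polynomials of degree less than `N` agree if the polynomials
agree at `N` points. -/
theorem eq_of_sum_mul_pow_eq {F : Type*} [Field F] {N : ℕ} (T : Finset F) (hT : N ≤ T.card)
    {v w : Fin N → F} (h : ∀ x ∈ T, ∑ u, v u * x ^ (u : ℕ) = ∑ u, w u * x ^ (u : ℕ)) : v = w := by
  have hcoeff : ∀ (v : Fin N → F) (u : Fin N), (∑ i, C (v i) * X ^ (i : ℕ)).coeff u = v u := by
    intro v u
    rw [finsetSum_coeff, Finset.sum_eq_single u]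
    · simp
    · intro i _ hi
      simp [coeff_X_pow, Fin.val_inj, hi.symm]
    · simp
  have hdeg : ∀ v : Fin N → F, (∑ i, C (v i) * X ^ (i : ℕ)).degree < (T.card : WithBot ℕ) := fun v =>
    (degree_sum_fin_lt v).trans_le (by exact_mod_cast hT)
  have := eq_of_degrees_lt_of_eval_finset_eq T (hdeg v) (hdeg w) (by
    intro x hx
    simpa [eval_finsetSum] using h x hx)
  funext u
  rw [← hcoeff v u, this, hcoeff]

open Polynomial in
/-- Interpolation at no more than `K` points, in terms of `K` coefficients. -/
theorem exists_sum_mul_pow_eq {F : Type*} [Field F] {K : ℕ} (T : Finset F) (hT : T.card ≤ K)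
    (g : F → F) : ∃ r : Fin K → F, ∀ x ∈ T, ∑ u, r u * x ^ (u : ℕ) = g x := by
  classical
  have hinj : Set.InjOn (id : F → F) T := Function.injective_id.injOn
  refine ⟨fun u => (Lagrange.interpolate T id g).coeff u, fun x hx => ?_⟩
  have hdeg : (Lagrange.interpolate T id g).degree < K :=
    (Lagrange.degree_interpolate_lt g hinj).trans_le (by exact_mod_cast hT)
  rw [Fin.sum_univ_eq_sum_range fun u => (Lagrange.interpolate T id g).coeff u * x ^ u]
  have h := Lagrange.eval_interpolate_at_node g hinj hx
  rw [id, eval_eq_sum, sum_over_range' _ (by simp) (K) ?_] at h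
  · exact h
  -- The zero polynomial has `natDegree` 0, so this case needs K > 0, which the point x of `T`
  -- provides.
  · by_cases h0 : Lagrange.interpolate T id g = 0
    · have : 0 < K := (Finset.card_pos.2 ⟨x, hx⟩).trans_le hT
      simpa [h0] using this
    · exact (natDegree_lt_iff_degree_lt h0).2 hdeg

/-! ### Edges of the complete graph -/

/-- The edges of the complete graph on `Fin n` with an endpoint in `B`. -/
def incidentEdges {n : ℕ} (B : Finset (Fin n)) : Finset (Sym2 (Fin n)) :=
  Finset.univ.filter fun e => ¬ e.IsDiag ∧ ∃ i ∈ B, i ∈ e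

theorem mk_mem_incidentEdges {n : ℕ} {B : Finset (Fin n)} {i j : Fin n} (hi : i ∈ B)
    (hij : j ≠ i) : s(i, j) ∈ incidentEdges B := by
  simp only [incidentEdges, Finset.mem_filter, Finset.mem_univ, true_and, Sym2.mk_isDiag_iff]
  exact ⟨hij.symm, i, hi, Sym2.mem_mk_left i j⟩

theorem incidentEdges_insert {n : ℕ} {B : Finset (Fin n)} (a : Fin n) :
    incidentEdges (insert a B) =
      incidentEdges B ∪ (Finset.univ \ insert a B).image fun j => s(a, j) := by
  ext e
  induction e using Sym2.ind with | _ x y =>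
  simp only [incidentEdges, Finset.mem_filter, Finset.mem_univ, true_and, Sym2.mk_isDiag_iff,
    Finset.mem_insert, exists_eq_or_imp, Sym2.mem_iff, Finset.mem_union, Finset.mem_image,
    Finset.mem_sdiff, Sym2.eq_iff, not_or]
  constructor
  · rintro ⟨hxy, h⟩
    by_cases hB : ∃ i ∈ B, i = x ∨ i = y
    · exact Or.inl ⟨hxy, hB⟩
    · right
      rcases h with (rfl | rfl) | h
      · exact ⟨y, ⟨Ne.symm hxy, fun hy => hB ⟨y, hy, Or.inr rfl⟩⟩, Or.inl ⟨rfl, rfl⟩⟩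
      · exact ⟨x, ⟨hxy, fun hy => hB ⟨x, hy, Or.inl rfl⟩⟩, Or.inr ⟨rfl, rfl⟩⟩
      · exact absurd h hB
  · rintro (⟨hxy, h⟩ | ⟨j, ⟨hja, -⟩, (⟨rfl, rfl⟩ | ⟨rfl, rfl⟩)⟩)
    · exact ⟨hxy, Or.inr h⟩
    · exact ⟨Ne.symm hja, Or.inl (Or.inl rfl)⟩
    · exact ⟨hja, Or.inl (Or.inr rfl)⟩

/-- The i-th vertex added to the set brings exactly its edges to the n - i vertices still outside.
-/
theorem card_incidentEdges {n : ℕ} (B : Finset (Fin n)) :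
    (incidentEdges B).card = ∑ i ∈ Finset.Icc 1 B.card, (n - i) := by
  induction B using Finset.induction_on with
  | empty => simp [incidentEdges]
  | insert a B ha ih =>
    rw [incidentEdges_insert, Finset.card_union_of_disjoint, ih, Finset.card_image_of_injective,
      Finset.card_univ_sdiff, Fintype.card_fin, Finset.card_insert_of_notMem ha,
      Finset.sum_Icc_succ_top (by omega)]
    · exact fun x y h => Sym2.congr_right.1 h
    · rw [Finset.disjoint_left]
      intro e he he'
      obtain ⟨j, hj, rfl⟩ := Finset.mem_image.1 he'
      simp only [Finset.mem_sdiff, Finset.mem_univ, true_and, Finset.mem_insert, not_or] at hj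
      simp only [incidentEdges, Finset.mem_filter, Sym2.mem_iff] at he
      obtain ⟨i, hi, (rfl | rfl)⟩ := he.2.2
      · exact ha hi
      · exact hj.2 hi

/-- This is the source of the field size n (n - 1) / 2: each edge needs its own evaluation point.
Diagonal pairs receive an irrelevant value. -/
theorem exists_injOn_edges {F : Type*} [Fintype F] [Nonempty F] {n : ℕ}
    (h : n * (n - 1) / 2 ≤ Fintype.card F) :
    ∃ pt : Sym2 (Fin n) → F, Set.InjOn pt {e | ¬ e.IsDiag} := by
  classical
  obtain ⟨f⟩ := Function.Embedding.nonempty_of_card_le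
    (α := {e : Sym2 (Fin n) // ¬ e.IsDiag}) (β := F) (by
      rwa [Sym2.card_subtype_not_diag, Fintype.card_fin, Nat.choose_two_right])
  refine ⟨fun e => if he : ¬ e.IsDiag then f ⟨e, he⟩ else Classical.arbitrary F, ?_⟩
  intro e he e' he' hee
  simp only [Set.mem_ofPred_eq] at he he'
  simpa [he, he'] using hee

theorem injOn_incidentEdges {F : Type*} {n : ℕ} {pt : Sym2 (Fin n) → F}
    (hpt : Set.InjOn pt {e | ¬ e.IsDiag}) (B : Finset (Fin n)) :
    Set.InjOn pt (incidentEdges B) :=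
  hpt.mono fun _ he => (Finset.mem_filter.1 he).2.1

/-- A repair that contacts `n - 1` nodes contacts all surviving nodes. -/
theorem RepairEvent.mem_helpers {n : ℕ} (e : RepairEvent n (n - 1)) {j : Fin n}
    (hj : j ≠ e.failed) : j ∈ e.helpers := by
  have : e.helpers = Finset.univ.erase e.failed :=
    Finset.eq_of_subset_of_card_le
      (fun i hi => Finset.mem_erase.2
        ⟨fun h => e.failed_notMem (h ▸ hi), Finset.mem_univ _⟩)
      (by rw [e.card_helpers, Finset.card_erase_of_mem (Finset.mem_univ _), Finset.card_univ,
        Fintype.card_fin])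
  rw [this]
  exact Finset.mem_erase.2 ⟨hj, Finset.mem_univ _⟩

/-! ### Repair by transfer with nested Reed–Solomon codes -/

section RepairByTransfer

variable {F : Type} [Field F] [Fintype F] {n a b R K N : ℕ}
  (pt : Sym2 (Fin n) → F) (φ : Fin R ≃ Fin N × Fin b)
  (idx : ∀ i : Fin n, Fin a ≃ {j : Fin n // j ≠ i} × Fin b)

/-- The symbols attached to the edge `e`: the value at `pt e` of the polynomials whose lowest `K`
coefficients are the random `r`, followed by the `N` coefficients of the file `s`. -/
def edgeSymbol (s : Fin R → F) (r : Fin K → Fin b → F) (e : Sym2 (Fin n)) (c : Fin b) : F :=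
  ∑ u, r u c * pt e ^ (u : ℕ) + ∑ v, s (φ.symm (v, c)) * pt e ^ (K + (v : ℕ))

/-- The contents of the nodes: each node stores the symbols of its incident edges. -/
def edgeContents (s : Fin R → F) (r : Fin K → Fin b → F) (i : Fin n) (m : Fin a) : F :=
  edgeSymbol pt φ s r s(i, (idx i m).1.1) (idx i m).2

/-- Each edge of the complete graph carries `b` symbols, stored at both of its endpoints, which are
transferred in repairs without change. -/
noncomputable def repairByTransfer (K : ℕ) : StorageScheme F n (n - 1) a b R where
  encode s := (PMF.uniformOfFintype (Fin K → Fin b → F)).map (edgeContents pt φ idx s)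
  send _ e j C c := if h : e.failed ≠ j then C ((idx j).symm (⟨e.failed, h⟩, c)) else 0
  regenerate _ e D m := D (idx e.failed m).1.1 (idx e.failed m).2

theorem exists_of_mem_support_law {ω : (Fin R → F) × (Fin n → Fin a → F)}
    (hω : ω ∈ (repairByTransfer pt φ idx K).law.support) :
    ∃ r : Fin K → Fin b → F, ω.2 = edgeContents pt φ idx ω.1 r := by
  rw [StorageScheme.mem_support_law] at hω
  obtain ⟨r, -, hr⟩ := (PMF.mem_support_map_iff ..).1 hω
  exact ⟨r, hr.symm⟩

theorem download_edgeContents (σ : ℕ → RepairEvent n (n - 1)) (t : ℕ) (s : Fin R → F)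
    (r : Fin K → Fin b → F) {j : Fin n} (hj : j ≠ (σ t).failed) (c : Fin b) :
    (repairByTransfer pt φ idx K).download σ t (edgeContents pt φ idx s r) j c =
      edgeSymbol pt φ s r s((σ t).failed, j) c := by
  simp [StorageScheme.download, RepairEvent.mem_helpers _ hj, repairByTransfer, hj.symm,
    edgeContents, Sym2.eq_swap]

/-- Every lost symbol has a second copy at the other endpoint of its edge, and all survivors are
contacted, so each repair is exact. -/
theorem stored_repairByTransfer (σ : ℕ → RepairEvent n (n - 1)) (s : Fin R → F)
    (r : Fin K → Fin b → F) (t : ℕ) :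
    (repairByTransfer pt φ idx K).stored σ t (s, edgeContents pt φ idx s r) =
      edgeContents pt φ idx s r := by
  induction t with
  | zero => rfl
  | succ t ih =>
    rw [StorageScheme.stored, ih, Function.update_eq_self_iff]
    funext m
    exact download_edgeContents pt φ idx σ t s r (idx _ m).1.2 _

omit [Fintype F] in
theorem edgeSymbol_eq_of_edgeContents_eq {s s' : Fin R → F} {r r' : Fin K → Fin b → F}
    {B : Finset (Fin n)}
    (h : ∀ i ∈ B, edgeContents pt φ idx s r i = edgeContents pt φ idx s' r' i)
    {e : Sym2 (Fin n)} (he : e ∈ incidentEdges B) (c : Fin b) :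
    edgeSymbol pt φ s r e c = edgeSymbol pt φ s' r' e c := by
  obtain ⟨hd, i, hi, hie⟩ := (Finset.mem_filter.1 he).2
  obtain ⟨j, rfl⟩ := hie
  have hj : j ≠ i := fun h => hd (by simp [h])
  have := congrFun (h i hi) ((idx i).symm (⟨j, hj⟩, c))
  simpa [edgeContents] using this

omit [Fintype F] in
theorem edgeSymbol_eq_sum_append (s : Fin R → F) (r : Fin K → Fin b → F) (e : Sym2 (Fin n))
    (c : Fin b) : edgeSymbol pt φ s r e c =
      ∑ u, Fin.append (fun u => r u c) (fun v => s (φ.symm (v, c))) u * pt e ^ (u : ℕ) := by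
  simp [edgeSymbol, Fin.sum_univ_add]

/-- The edges meeting k slots give at least K + N values of each polynomial, which has K + N
coefficients; the file is read off the upper N of them. -/
theorem reconstructs_repairByTransfer (hpt : Set.InjOn pt {e | ¬ e.IsDiag}) {k : ℕ}
    (hk : K + N ≤ ∑ i ∈ Finset.Icc 1 k, (n - i)) :
    (repairByTransfer pt φ idx K).Reconstructs k := by
  classical
  intro σ t B hB
  apply shannonCondEntropy_eq_zero
  rintro ⟨s, c⟩ hω ⟨s', c'⟩ hω' hY
  obtain ⟨r, hr⟩ := exists_of_mem_support_law pt φ idx hω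
  obtain ⟨r', hr'⟩ := exists_of_mem_support_law pt φ idx hω'
  simp only at hr hr' ⊢
  subst hr hr'
  simp only [stored_repairByTransfer] at hY
  have hsym := fun e he c => edgeSymbol_eq_of_edgeContents_eq pt φ idx (B := B) (e := e)
    (fun i hi => congrFun hY ⟨i, hi⟩) he c
  have key : ∀ c, _ := fun c => eq_of_sum_mul_pow_eq ((incidentEdges B).image pt)
    (N := K + N) (v := Fin.append (fun u => r u c) fun v => s (φ.symm (v, c)))
    (w := Fin.append (fun u => r' u c) fun v => s' (φ.symm (v, c)))
    (by rwa [Finset.card_image_of_injOn (injOn_incidentEdges hpt B), card_incidentEdges, hB])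
    (by
      intro x hx
      obtain ⟨e, he, rfl⟩ := Finset.mem_image.1 hx
      simpa only [edgeSymbol_eq_sum_append] using hsym e he c)
  funext x
  have := congrFun (key (φ x).2) (Fin.natAdd K (φ x).1)
  simpa using this

omit [Fintype F] in
/-- On few edges, the symbols of one file become those of another by a shift of the randomness. -/
theorem exists_edgeSymbol_shift (hpt : Set.InjOn pt {e | ¬ e.IsDiag}) (B : Finset (Fin n))
    (hB : ∑ i ∈ Finset.Icc 1 B.card, (n - i) ≤ K) (s s' : Fin R → F) :
    ∃ r₀ : Fin K → Fin b → F, ∀ r, ∀ e ∈ incidentEdges B, ∀ c,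
      edgeSymbol pt φ s r e c = edgeSymbol pt φ s' (r + r₀) e c := by
  classical
  choose r₀ hr₀ using fun c : Fin b => exists_sum_mul_pow_eq ((incidentEdges B).image pt) (K := K)
    (by rwa [Finset.card_image_of_injOn (injOn_incidentEdges hpt B), card_incidentEdges])
    (fun x => ∑ v, s (φ.symm (v, c)) * x ^ (K + (v : ℕ)) -
      ∑ v, s' (φ.symm (v, c)) * x ^ (K + (v : ℕ)))
  refine ⟨fun u c => r₀ c u, fun r e he c => ?_⟩
  have := hr₀ c (pt e) (Finset.mem_image_of_mem _ he)
  simp only [edgeSymbol, Pi.add_apply, add_mul, Finset.sum_add_distrib, this]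
  ring

/-- Initial or replacement, a node reveals only the symbols on the edges at its slot; `Sum.elim id
_` sends a node to that slot. -/
theorem revealed_congr (σ : ℕ → RepairEvent n (n - 1)) {s s' : Fin R → F}
    {r r' : Fin K → Fin b → F} {B : Finset (Fin n)}
    (h : ∀ e ∈ incidentEdges B, ∀ c, edgeSymbol pt φ s r e c = edgeSymbol pt φ s' r' e c)
    (v : Fin n ⊕ ℕ) (hv : Sum.elim id (fun t => (σ t).failed) v ∈ B) :
    (repairByTransfer pt φ idx K).revealed σ (s, edgeContents pt φ idx s r) v =
      (repairByTransfer pt φ idx K).revealed σ (s', edgeContents pt φ idx s' r') v := by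
  rcases v with i | t
  · refine congrArg Sum.inl (funext fun m => h _ ?_ _)
    exact mk_mem_incidentEdges hv (idx i m).1.2
  · simp only [StorageScheme.revealed, stored_repairByTransfer]
    refine congrArg Sum.inr (funext fun j => funext fun c => ?_)
    by_cases hj : j = (σ t).failed
    · have : j ∉ (σ t).helpers := hj ▸ (σ t).failed_notMem
      simp [StorageScheme.download, this]
    · rw [download_edgeContents _ _ _ _ _ _ _ hj, download_edgeContents _ _ _ _ _ _ _ hj]
      exact h _ (mk_mem_incidentEdges hv hj) c

/-- A change of file is absorbed by a translation of the randomness, which preserves the uniform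
law. Hence the revealed data have the same conditional law for every file and are independent of it.
-/
theorem secure_repairByTransfer (hpt : Set.InjOn pt {e | ¬ e.IsDiag}) {ℓ : ℕ}
    (hℓ : ∑ i ∈ Finset.Icc 1 ℓ, (n - i) ≤ K) :
    (repairByTransfer pt φ idx K).Secure ℓ := by
  classical
  intro σ E hE
  apply shannonCondEntropy_eq_shannonEntropy
  set sch := repairByTransfer pt φ idx K
  let D := fun (ω : (Fin R → F) × (Fin n → Fin a → F)) (v : {v // v ∈ E}) => sch.revealed σ ω v
  let g : (Fin R → F) → (Fin K → Fin b → F) → {v // v ∈ E} → (Fin a → F) ⊕ (Fin n → Fin b → F) :=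
    fun s r => D (s, edgeContents pt φ idx s r)
  -- The slots of the accessed nodes. Several nodes may have occupied the same slot at different
  -- times, which only makes `B` smaller.
  let B := E.image (Sum.elim id fun t => (σ t).failed)
  have hB : ∑ i ∈ Finset.Icc 1 B.card, (n - i) ≤ K :=
    (Finset.sum_le_sum_of_subset (Finset.Icc_subset_Icc_right
      (Finset.card_image_le.trans hE))).trans hℓ
  have hg : ∀ s, (PMF.uniformOfFintype (Fin K → Fin b → F)).map (g s) =
      (PMF.uniformOfFintype (Fin K → Fin b → F)).map (g 0) := by
    intro s
    obtain ⟨r₀, hr₀⟩ := exists_edgeSymbol_shift pt φ hpt B hB s 0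
    have : g s = g 0 ∘ Equiv.addRight r₀ := by
      funext r v
      exact revealed_congr pt φ idx σ (hr₀ r) v.1 (Finset.mem_image_of_mem _ v.2)
    rw [this, ← PMF.map_comp, map_uniformOfFintype_equiv]
  have hlaw : ∀ {C : Type} (f : (Fin R → F) × (Fin n → Fin a → F) → C), sch.law.map f =
      (PMF.uniformOfFintype (Fin R → F)).bind fun s =>
        (PMF.uniformOfFintype (Fin K → Fin b → F)).map
          fun r => f (s, edgeContents pt φ idx s r) := by
    intro C f
    rw [StorageScheme.law, PMF.map_bind]
    simp only [sch, repairByTransfer, PMF.map_comp]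
    rfl
  have hD : sch.law.map D = (PMF.uniformOfFintype (Fin K → Fin b → F)).map (g 0) := by
    rw [hlaw]
    exact (congrArg _ (funext hg)).trans (PMF.bind_const _ _)
  have hjoint : sch.law.map (fun ω => (ω.1, D ω)) = (PMF.uniformOfFintype (Fin R → F)).bind
      fun s => (sch.law.map D).map fun d => (s, d) := by
    rw [hD, hlaw]
    congr 1
    funext s
    rw [← hg s, PMF.map_comp]
    rfl
  intro s d
  change (sch.law.map fun ω => (ω.1, D ω)) (s, d) = _ * (sch.law.map D) d
  rw [hjoint, sch.map_fst_law, PMF.bind_apply, tsum_eq_single s]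
  · congr 1
    rw [PMF.map_apply, tsum_eq_single d]
    · simp
    · intro d' hd'
      simp [hd'.symm]
  · intro s' hs'
    rw [PMF.map_apply]
    simp [hs'.symm]

end RepairByTransfer

/-- Attainment of the secrecy capacity over fields with at least `n (n - 1) / 2` elements. -/
theorem exists_scheme_reconstructs_secure (F : Type) [Field F] [Fintype F] {n k ℓ : ℕ} (b : ℕ)
    (hℓ : ℓ < k) (hF : n * (n - 1) / 2 ≤ Fintype.card F) :
    ∃ sch : StorageScheme F n (n - 1) ((n - 1) * b) b (∑ i ∈ Finset.Icc (ℓ + 1) k, (n - i) * b),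
      sch.Reconstructs k ∧ sch.Secure ℓ := by
  obtain ⟨pt, hpt⟩ := exists_injOn_edges hF
  have φ : Fin (∑ i ∈ Finset.Icc (ℓ + 1) k, (n - i) * b) ≃
      Fin (∑ i ∈ Finset.Icc (ℓ + 1) k, (n - i)) × Fin b :=
    Fintype.equivOfCardEq (by simp [Finset.sum_mul])
  have idx : ∀ i : Fin n, Fin ((n - 1) * b) ≃ {j : Fin n // j ≠ i} × Fin b := fun i =>
    Fintype.equivOfCardEq (by simp [Fintype.card_subtype_compl])
  refine ⟨repairByTransfer pt φ idx (∑ i ∈ Finset.Icc 1 ℓ, (n - i)),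
    reconstructs_repairByTransfer pt φ idx hpt ?_, secure_repairByTransfer pt φ idx hpt le_rfl⟩
  -- K + N is the sum over 1, ..., k, split at ℓ.
  have := Finset.sum_Ioc_consecutive (fun i => n - i) (Nat.zero_le ℓ) hℓ.le
  have hIoc : ∀ c d : ℕ, Finset.Icc (c + 1) d = Finset.Ioc c d := by
    intro c d; ext; simp only [Finset.mem_Icc, Finset.mem_Ioc]; omega
  rw [← hIoc, ← hIoc, ← hIoc] at this
  exact this.le

/-! ### From schemes to capacities -/

theorem sum_cast_sub_eq {n k ℓ : ℕ} (hk : k ≤ n) :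
    ((∑ i ∈ Finset.Icc (ℓ + 1) k, (n - i) : ℕ) : ℝ) = ∑ i ∈ Finset.Icc (ℓ + 1) k, ((n : ℝ) - i) := by
  rw [Nat.cast_sum]
  refine Finset.sum_congr rfl fun i hi => ?_
  rw [Nat.cast_sub ((Finset.mem_Icc.1 hi).2.trans hk)]

/-- The constraint (n - 1) b ≤ m γ turns the symbol count of the converse into b / m ≤ Γ / (n - 1)
data units per link. -/
theorem secrecyCapacityOver_le (F : Type) [Field F] [Fintype F] {m n k ℓ : ℕ} (hm : 0 < m)
    (hℓ : ℓ < k) (hk : k ≤ n - 1) {α γ Γ : ℝ} (hγ : γ ≤ Γ) :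
    secrecyCapacityOver F m n k (n - 1) ℓ α γ ≤
      ((∑ i ∈ Finset.Icc (ℓ + 1) k, ((n : ℝ) - i) * (Γ / ((n : ℝ) - 1)) : ℝ) : EReal) := by
  refine iSup_le fun a => iSup_le fun b => iSup_le fun R => iSup_le fun sch => iSup_le ?_
  rintro ⟨-, hb, hrec, hsec⟩
  have hn : (1 : ℝ) < n := by exact_mod_cast (show 1 < n by omega)
  have hm' : (0 : ℝ) < m := by exact_mod_cast hm
  have hR := sch.size_le_of_reconstructs_of_secure hℓ (hk.trans (Nat.sub_le _ _)) hrec hsec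
  rw [← Finset.sum_mul] at hR
  have hR' : (R : ℝ) ≤ (∑ i ∈ Finset.Icc (ℓ + 1) k, (n - i) : ℕ) * b := by exact_mod_cast hR
  rw [Nat.cast_sub (show 1 ≤ n by omega), Nat.cast_one] at hb
  rw [EReal.coe_le_coe_iff, sch.fileEntropy_eq, ← Finset.sum_mul,
    ← sum_cast_sub_eq (hk.trans (Nat.sub_le _ _)), div_le_iff₀ hm', mul_assoc]
  refine hR'.trans (mul_le_mul_of_nonneg_left ?_ (Nat.cast_nonneg _))
  rw [div_mul_eq_mul_div, le_div_iff₀ (by linarith)]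
  have := mul_le_mul_of_nonneg_left hγ hm'.le
  linarith

theorem le_secrecyCapacityOver (F : Type) [Field F] [Fintype F] {m n k ℓ : ℕ} (b : ℕ)
    (hℓ : ℓ < k) (hk : k ≤ n - 1) (hF : n * (n - 1) / 2 ≤ Fintype.card F) {Γ : ℝ}
    (hb : ((n : ℝ) - 1) * b ≤ m * Γ) :
    (((∑ i ∈ Finset.Icc (ℓ + 1) k, ((n : ℝ) - i)) * (b / m) : ℝ) : EReal) ≤
      secrecyCapacityOver F m n k (n - 1) ℓ Γ Γ := by
  obtain ⟨sch, hrec, hsec⟩ := exists_scheme_reconstructs_secure F b hℓ hF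
  have hb' : ((n - 1 : ℕ) : ℝ) * b ≤ m * Γ := by
    rwa [Nat.cast_sub (show 1 ≤ n by omega), Nat.cast_one]
  refine le_trans (le_of_eq ?_) (le_iSup_of_le ((n - 1) * b) <| le_iSup_of_le b <|
    le_iSup_of_le _ <| le_iSup_of_le sch <|
      le_iSup_of_le ⟨by push_cast; exact hb', hb', hrec, hsec⟩ le_rfl)
  rw [sch.fileEntropy_eq, ← Finset.sum_mul, ← sum_cast_sub_eq (hk.trans (Nat.sub_le _ _)),
    Nat.cast_mul, mul_div_assoc]

/-- With x = Γ / (n - 1) and b = ⌊x m⌋, each m > 0 yields a scheme with b / m units per link, and b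
/ m tends to x. A single prime field `ZMod p` with p ≥ n (n - 1) / 2 serves all m. -/
theorem le_secrecyCapacity {n k ℓ : ℕ} (hℓ : ℓ < k) (hk : k ≤ n - 1) {Γ : ℝ} (hΓ : 0 ≤ Γ) :
    ((∑ i ∈ Finset.Icc (ℓ + 1) k, ((n : ℝ) - i) * (Γ / ((n : ℝ) - 1)) : ℝ) : EReal) ≤
      secrecyCapacity n k (n - 1) ℓ Γ Γ := by
  obtain ⟨p, hp, hprime⟩ := Nat.exists_infinite_primes (n * (n - 1) / 2)
  have : Fact p.Prime := ⟨hprime⟩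
  have hn : (0 : ℝ) < (n : ℝ) - 1 := by
    rw [sub_pos]; exact_mod_cast (show 1 < n by omega)
  have hx : 0 ≤ Γ / ((n : ℝ) - 1) := div_nonneg hΓ hn.le
  rw [← Finset.sum_mul]
  have hlim := (continuous_coe_real_ereal.tendsto _).comp
    (((tendsto_nat_floor_mul_div_atTop hx).comp tendsto_natCast_atTop_atTop).const_mul
      (∑ i ∈ Finset.Icc (ℓ + 1) k, ((n : ℝ) - i)))
  refine le_of_tendsto hlim ?_
  filter_upwards [Filter.eventually_gt_atTop 0] with m hm
  refine (le_secrecyCapacityOver (ZMod p) (m := m) (Γ := Γ) ⌊Γ / ((n : ℝ) - 1) * m⌋₊ hℓ hk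
    (by rwa [ZMod.card]) ?_).trans (b := secrecyCapacityOver (ZMod p) m n k (n - 1) ℓ Γ Γ) ?_
  · have := Nat.floor_le (mul_nonneg hx (Nat.cast_nonneg m))
    calc ((n : ℝ) - 1) * ⌊Γ / ((n : ℝ) - 1) * m⌋₊
        ≤ ((n : ℝ) - 1) * (Γ / ((n : ℝ) - 1) * m) := mul_le_mul_of_nonneg_left this hn.le
      _ = m * Γ := by field_simp
  · exact le_iSup_of_le (ZMod p) <| le_iSup_of_le inferInstance <| le_iSup_of_le inferInstance <|
      le_iSup_of_le m <| le_iSup_of_le hm le_rfl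

theorem secrecyCapacity_le {n k ℓ : ℕ} (hℓ : ℓ < k) (hk : k ≤ n - 1) {α γ Γ : ℝ} (hγ : γ ≤ Γ) :
    secrecyCapacity n k (n - 1) ℓ α γ ≤
      ((∑ i ∈ Finset.Icc (ℓ + 1) k, ((n : ℝ) - i) * (Γ / ((n : ℝ) - 1)) : ℝ) : EReal) :=
  iSup_le fun F => iSup_le fun _ => iSup_le fun _ => iSup_le fun _ => iSup_le fun hm =>
    secrecyCapacityOver_le F hm hℓ hk hγ

/-- Bandwidth-limited secrecy capacity for `d = n - 1`, and its attainment with `α = Γ`; over a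
field with at least `n (n - 1) / 2` elements it is attained by an actual scheme as soon as
`Γ / (n - 1)` data units are a whole number `b` of symbols (for example `m = 1`,
`Γ = (n - 1) b`). -/
theorem theorem2 (n k ℓ : ℕ) (hℓ : ℓ < k) (hk : k ≤ n - 1) (Γ : ℝ) (hΓ : 0 ≤ Γ) :
    bandwidthLimitedCapacity n k (n - 1) ℓ Γ =
        ((∑ i ∈ Finset.Icc (ℓ + 1) k, ((n : ℝ) - i) * (Γ / ((n : ℝ) - 1)) : ℝ) : EReal) ∧
      secrecyCapacity n k (n - 1) ℓ Γ Γ =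
        ((∑ i ∈ Finset.Icc (ℓ + 1) k, ((n : ℝ) - i) * (Γ / ((n : ℝ) - 1)) : ℝ) : EReal) ∧
      ∀ (F : Type) [Field F] [Fintype F] (m b : ℕ), 0 < m →
        (m : ℝ) * Γ = ((n : ℝ) - 1) * b → n * (n - 1) / 2 ≤ Fintype.card F →
        bandwidthLimitedCapacityOver F m n k (n - 1) ℓ Γ =
            ((∑ i ∈ Finset.Icc (ℓ + 1) k, ((n : ℝ) - i) * (Γ / ((n : ℝ) - 1)) : ℝ) : EReal) ∧
          secrecyCapacityOver F m n k (n - 1) ℓ Γ Γ =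
            ((∑ i ∈ Finset.Icc (ℓ + 1) k, ((n : ℝ) - i) * (Γ / ((n : ℝ) - 1)) : ℝ) : EReal) ∧
          ∃ sch : StorageScheme F n (n - 1) ((n - 1) * b) b
              (∑ i ∈ Finset.Icc (ℓ + 1) k, (n - i) * b),
            sch.Reconstructs k ∧ sch.Secure ℓ := by
  refine ⟨le_antisymm ?_ ?_, le_antisymm (secrecyCapacity_le hℓ hk le_rfl)
    (le_secrecyCapacity hℓ hk hΓ), ?_⟩
  · exact iSup_le fun γ => iSup_le fun hγ => iSup_le fun α => iSup_le fun _ =>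
      secrecyCapacity_le hℓ hk hγ.2
  · exact (le_secrecyCapacity hℓ hk hΓ).trans <| le_iSup_of_le Γ <|
      le_iSup_of_le ⟨hΓ, le_rfl⟩ <| le_iSup_of_le Γ <| le_iSup_of_le hΓ le_rfl
  · intro F _ _ m b hm hb hF
    have hn : (0 : ℝ) < (n : ℝ) - 1 := by
      rw [sub_pos]; exact_mod_cast (show 1 < n by omega)
    have hm' : (0 : ℝ) < m := by exact_mod_cast hm
    have hlow : ((∑ i ∈ Finset.Icc (ℓ + 1) k, ((n : ℝ) - i) * (Γ / ((n : ℝ) - 1)) : ℝ) : EReal) ≤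
        secrecyCapacityOver F m n k (n - 1) ℓ Γ Γ := by
      have hbm : Γ / ((n : ℝ) - 1) = b / m := by
        rw [div_eq_div_iff hn.ne' hm'.ne']
        linarith
      rw [← Finset.sum_mul, hbm]
      exact le_secrecyCapacityOver F b hℓ hk hF hb.ge
    refine ⟨le_antisymm ?_ ?_, le_antisymm (secrecyCapacityOver_le F hm hℓ hk le_rfl) hlow,
      exists_scheme_reconstructs_secure F b hℓ hF⟩
    · exact iSup_le fun γ => iSup_le fun hγ => iSup_le fun α => iSup_le fun _ =>
        secrecyCapacityOver_le F hm hℓ hk hγ.2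
    · exact hlow.trans <| le_iSup_of_le Γ <|
        le_iSup_of_le ⟨hΓ, le_rfl⟩ <| le_iSup_of_le Γ <| le_iSup_of_le hΓ le_rfl
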